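/- Rings are associative and unital, and modules are right modules. Let $R$ be a ring. A short exact sequence of $R$-modules is called pure if it remains exact under $\operatorname{Hom}_R(F,-)$ for every finitely presented $R$-module $F$; an $R$-module $P$ is pure projective if every pure epimorphism $X\to P$ splits. A pure projective resolution of $M$ is a complex $\cdots\to P_1\to P_0\to M\to 0$ with all $P_i$ pure projective which remains exact under $\operatorname{Hom}_R(F,-)$ for every finitely presented $F$. Such resolutions exist, and one sets $\mathrm{PExt}_R^n(M,N)=H^n(\operatorname{Hom}_R(P_\bullet,N))$, which does not depend on the resolution up to isomorphism. The pure global dimension of $R$ is $$\mathsf{pgdim}(R)=\sup_{M}\,\sup\{n\ge 0:\mathrm{PExt}_R^{n}(M,-)\neq 0\}\in\{-\infty\}\cup\mathbb{N}\cup\{\infty\},$$ where $M$ runs over all $R$-modules and $\sup\emptyset=-\infty$. A ring homomorphism $f\colon R\to S$ is a ring epimorphism if the restriction of scalars functor $\mathrm{Mod}(S)\to\mathrm{Mod}(R)$ along $f$ is fully faithful. **Proposition.** If $f\colon R\to S$ is a ring epimorphism, then $\mathsf{pgdim}(S)\le\mathsf{pgdim}(R)$. -/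

import Mathlib

open CategoryTheory

universe u

noncomputable section

namespace PureDim

section Purity

variable {A : Type u} [Ring A]

/-- A morphism `p : X ⟶ Y` of `A`-modules is a pure epimorphism if it is an epimorphism and the
short exact sequence `0 ⟶ ker p ⟶ X ⟶ Y ⟶ 0` stays exact under `Hom(F, -)` for every finitely
presented module `F`. Since `Hom(F, -)` is left exact, the latter means that every morphism
`F ⟶ Y` lifts along `p`. -/
def IsPureEpi {X Y : ModuleCat.{u} A} (p : X ⟶ Y) : Prop :=
  Epi p ∧ ∀ (F : ModuleCat.{u} A), Module.FinitePresentation A F →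
    ∀ g : F ⟶ Y, ∃ h : F ⟶ X, h ≫ p = g

/-- A module `P` is pure projective if every pure epimorphism `X ⟶ P` splits. -/
def IsPureProjective (P : ModuleCat.{u} A) : Prop :=
  ∀ (X : ModuleCat.{u} A) (p : X ⟶ P), IsPureEpi p → IsSplitEpi p

/-- A pair of composable morphisms `X ⟶ Y ⟶ Z` with zero composite is pure exact at `Y` if it
stays exact under `Hom(F, -)` for every finitely presented module `F`
(taking `F = A` shows that it is exact). -/
def IsPureExactAt {X Y Z : ModuleCat.{u} A} (d : X ⟶ Y) (e : Y ⟶ Z) : Prop :=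
  d ≫ e = 0 ∧ ∀ (F : ModuleCat.{u} A), Module.FinitePresentation A F →
    ∀ g : F ⟶ Y, g ≫ e = 0 → ∃ h : F ⟶ X, h ≫ d = g

/-- A pure projective resolution `⋯ ⟶ P₂ ⟶ P₁ ⟶ P₀ ⟶ M ⟶ 0` of a module `M`: a complex of pure
projective modules, augmented to `M`, such that the augmented complex is pure exact. -/
structure PureProjectiveResolution (M : ModuleCat.{u} A) where
  /-- The chain complex `P`. -/
  complex : ChainComplex (ModuleCat.{u} A) ℕ
  /-- The augmentation `P₀ ⟶ M`. -/
  augmentation : complex.X 0 ⟶ M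
  pureProjective : ∀ n, IsPureProjective (complex.X n)
  pureEpi : IsPureEpi augmentation
  pureExact_zero : IsPureExactAt (complex.d 1 0) augmentation
  pureExact_succ : ∀ n, IsPureExactAt (complex.d (n + 2) (n + 1)) (complex.d (n + 1) n)

/-! ### Existence of pure projective resolutions -/

/-- Morphisms to `M` from the finitely presented modules `Aⁿ / K`. -/
def CoverIndex (M : ModuleCat.{u} A) : Type u :=
  Σ (n : ℕ) (K : {K : Submodule A (Fin n → A) // K.FG}), ((Fin n → A) ⧸ K.1) →ₗ[A] M

/-- The direct sum of all sources of morphisms to `M` from modules `Aⁿ / K`. -/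
def cover (M : ModuleCat.{u} A) : ModuleCat.{u} A :=
  ModuleCat.of A (DirectSum (CoverIndex M) fun i => (Fin i.1 → A) ⧸ i.2.1.1)

open Classical in
/-- The evaluation morphism from the direct sum. -/
def coverMap (M : ModuleCat.{u} A) : cover M ⟶ M :=
  ModuleCat.ofHom (DirectSum.toModule A (CoverIndex M) M fun i => i.2.2)

theorem finitePresentation_quotient {n : ℕ} (K : Submodule A (Fin n → A)) (hK : K.FG) :
    Module.FinitePresentation A ((Fin n → A) ⧸ K) :=
  Module.finitePresentation_of_free_of_surjective K.mkQ K.mkQ_surjective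
    (by rwa [Submodule.ker_mkQ])

theorem coverMap_lift {M F : ModuleCat.{u} A} (hF : Module.FinitePresentation A F) (g : F ⟶ M) :
    ∃ h : F ⟶ cover M, h ≫ coverMap M = g := by
  classical
  obtain ⟨n, K, e, hK⟩ := Module.FinitePresentation.exists_fin A F
  let i : CoverIndex M := ⟨n, ⟨K, hK⟩, g.hom ∘ₗ e.symm.toLinearMap⟩
  refine ⟨ModuleCat.ofHom
    ((DirectSum.lof A (CoverIndex M) (fun i => (Fin i.1 → A) ⧸ i.2.1.1) i) ∘ₗ e.toLinearMap), ?_⟩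
  ext x
  change DirectSum.toModule A (CoverIndex M) M (fun i => i.2.2)
    (DirectSum.lof A (CoverIndex M) (fun i => (Fin i.1 → A) ⧸ i.2.1.1) i (e x)) = g.hom x
  rw [DirectSum.toModule_lof]
  change g.hom (e.symm (e x)) = g.hom x
  simp

theorem coverMap_isPureEpi (M : ModuleCat.{u} A) : IsPureEpi (coverMap M) := by
  refine ⟨?_, fun F hF g => coverMap_lift hF g⟩
  rw [ModuleCat.epi_iff_surjective]
  intro m
  obtain ⟨h, hh⟩ := coverMap_lift (M := M) (F := ModuleCat.of A A)
    (Module.finitePresentation_of_projective A A)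
    (ModuleCat.ofHom (LinearMap.toSpanSingleton A M m))
  refine ⟨h.hom (1 : A), ?_⟩
  have := congrArg (fun k => k.hom (1 : A)) hh
  simpa using this

theorem cover_isPureProjective (M : ModuleCat.{u} A) : IsPureProjective (cover M) := by
  classical
  intro X p hp
  have key : ∀ i : CoverIndex M, ∃ s : ((Fin i.1 → A) ⧸ i.2.1.1) →ₗ[A] X,
      p.hom ∘ₗ s = DirectSum.lof A (CoverIndex M) (fun i => (Fin i.1 → A) ⧸ i.2.1.1) i := by
    intro i
    obtain ⟨h, hh⟩ := hp.2 (ModuleCat.of A ((Fin i.1 → A) ⧸ i.2.1.1))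
      (finitePresentation_quotient i.2.1.1 i.2.1.2)
      (ModuleCat.ofHom
        (DirectSum.lof A (CoverIndex M) (fun i => (Fin i.1 → A) ⧸ i.2.1.1) i))
    exact ⟨h.hom, congrArg ModuleCat.Hom.hom hh⟩
  choose s hs using key
  refine IsSplitEpi.mk' ⟨ModuleCat.ofHom (DirectSum.toModule A (CoverIndex M) X s), ?_⟩
  apply ModuleCat.hom_ext
  apply DirectSum.linearMap_ext
  intro i
  apply LinearMap.ext
  intro x
  change p.hom (DirectSum.toModule A (CoverIndex M) X s (DirectSum.lof A (CoverIndex M)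
    (fun i => (Fin i.1 → A) ⧸ i.2.1.1) i x)) = DirectSum.lof A (CoverIndex M)
    (fun i => (Fin i.1 → A) ⧸ i.2.1.1) i x
  rw [DirectSum.toModule_lof]
  exact LinearMap.congr_fun (hs i) x

/-- The iterated kernels of the covers: `Ω⁰ M = M` and `Ωⁿ⁺¹ M = ker (cover (Ωⁿ M) ⟶ Ωⁿ M)`. -/
def syzygy (M : ModuleCat.{u} A) : ℕ → ModuleCat.{u} A
  | 0 => M
  | n + 1 => ModuleCat.of A (LinearMap.ker (coverMap (syzygy M n)).hom)

/-- The inclusion of the next syzygy. -/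
def syzygyι (M : ModuleCat.{u} A) (n : ℕ) : syzygy M (n + 1) ⟶ cover (syzygy M n) :=
  ModuleCat.ofHom (LinearMap.ker (coverMap (syzygy M n)).hom).subtype

/-- The differentials of the resolution by covers. -/
def coverD (M : ModuleCat.{u} A) (n : ℕ) : cover (syzygy M (n + 1)) ⟶ cover (syzygy M n) :=
  coverMap (syzygy M (n + 1)) ≫ syzygyι M n

theorem syzygyι_coverMap (M : ModuleCat.{u} A) (n : ℕ) :
    syzygyι M n ≫ coverMap (syzygy M n) = 0 := by
  ext x
  exact x.2

theorem coverD_pureExact (M : ModuleCat.{u} A) (n : ℕ) :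
    IsPureExactAt (coverD M n) (coverMap (syzygy M n)) := by
  refine ⟨by rw [coverD, Category.assoc, syzygyι_coverMap, Limits.comp_zero], ?_⟩
  intro F hF g hg
  let g' : F ⟶ syzygy M (n + 1) := ModuleCat.ofHom
    (LinearMap.codRestrict (LinearMap.ker (coverMap (syzygy M n)).hom) g.hom
      fun x => LinearMap.mem_ker.2 (congrArg (fun k => k.hom x) hg))
  obtain ⟨h, hh⟩ := coverMap_lift hF g'
  refine ⟨h, ?_⟩
  rw [coverD, ← Category.assoc, hh]
  rfl

theorem syzygyι_mono (M : ModuleCat.{u} A) (n : ℕ) : Mono (syzygyι M n) := by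
  rw [ModuleCat.mono_iff_injective]
  exact Subtype.val_injective

theorem coverD_pureExact_succ (M : ModuleCat.{u} A) (n : ℕ) :
    IsPureExactAt (coverD M (n + 1)) (coverD M n) := by
  obtain ⟨h0, h1⟩ := coverD_pureExact M (n + 1)
  refine ⟨?_, fun F hF g hg => h1 F hF g ?_⟩
  · change coverD M (n + 1) ≫ coverMap _ ≫ syzygyι M n = 0
    rw [← Category.assoc, h0, Limits.zero_comp]
  · have := syzygyι_mono M n
    rw [← cancel_mono (syzygyι M n), Limits.zero_comp, Category.assoc]
    exact hg

/-- The resolution of `M` by iterated covers. -/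
def coverResolution (M : ModuleCat.{u} A) : PureProjectiveResolution M where
  complex := ChainComplex.of (fun n => cover (syzygy M n)) (coverD M)
    fun n => (coverD_pureExact_succ M n).1
  augmentation := coverMap M
  pureProjective n := cover_isPureProjective (syzygy M n)
  pureEpi := coverMap_isPureEpi M
  pureExact_zero := by
    have h : (ChainComplex.of (fun n => cover (syzygy M n)) (coverD M)
        fun n => (coverD_pureExact_succ M n).1).d 1 0 = coverD M 0 :=
      ChainComplex.of_d (fun n => cover (syzygy M n)) (coverD M) 0
    rw [h]
    exact coverD_pureExact M 0
  pureExact_succ n := by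
    have h : ∀ k, (ChainComplex.of (fun n => cover (syzygy M n)) (coverD M)
        fun n => (coverD_pureExact_succ M n).1).d (k + 1) k = coverD M k :=
      fun k => ChainComplex.of_d (fun n => cover (syzygy M n)) (coverD M) k
    rw [h n, h (n + 1)]
    exact coverD_pureExact_succ M n

/-! ### `PExt` and pure dimensions -/

/-- `PExtⁿ(M, N)`: the `n`-th cohomology group of the cochain complex of abelian groups
`Hom(P₀, N) ⟶ Hom(P₁, N) ⟶ Hom(P₂, N) ⟶ ⋯`, where `P` is the pure projective
resolution `coverResolution M` of `M` (any other one has isomorphic cohomology). -/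
def PExt (n : ℕ) (M N : ModuleCat.{u} A) : ModuleCat.{u} ℤ :=
  ((coverResolution M).complex.linearYonedaObj ℤ N).homology n

/-- The pure projective dimension `sup {n | PExtⁿ(M, -) ≠ 0}`, where the supremum of the empty set
is `⊥` (which stands for `-∞`). -/
def ppd (M : ModuleCat.{u} A) : WithBot ℕ∞ :=
  ⨆ (n : ℕ) (_ : ∃ N : ModuleCat.{u} A, Nontrivial (PExt n M N)), ((n : ℕ∞) : WithBot ℕ∞)

end Purity

/-- The pure global dimension of the category of `A`-modules. -/
def moduleCatPgdim (A : Type u) [Ring A] : WithBot ℕ∞ :=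
  ⨆ M : ModuleCat.{u} A, ppd M

/-- The category of right modules over a ring `R`: right `R`-modules are (left) modules over the
opposite ring. -/
abbrev RightMod (R : Type u) [Ring R] := ModuleCat.{u} Rᵐᵒᵖ

/-- The pure global dimension of a ring `R`, that is, of the category of right `R`-modules. -/
def pgdim (R : Type u) [Ring R] : WithBot ℕ∞ :=
  moduleCatPgdim Rᵐᵒᵖ

/-- Restriction of scalars from right `S`-modules to right `R`-modules along `f : R →+* S`. -/
def restriction {R S : Type u} [Ring R] [Ring S] (f : R →+* S) : RightMod S ⥤ RightMod R :=
  ModuleCat.restrictScalars (RingHom.op f)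

/-- A ring homomorphism is a ring epimorphism if restriction of scalars along it is fully
faithful. -/
def IsRingEpi {R S : Type u} [Ring R] [Ring S] (f : R →+* S) : Prop :=
  (restriction f).Full ∧ (restriction f).Faithful

end PureDim

end

noncomputable section

namespace PureDim

/-! ### Independence of vanishing from the resolution. -/

section Syzygies

variable {A : Type u} [Ring A]

/-! For an `S`-module `M`, resolve its restriction purely over `R` and extend scalars. The result is
a pure projective resolution over `S`: restriction preserves pure epimorphisms, so its left adjoint
preserves pure projectives, and extension keeps the pieces `0 ⟶ K (n + 1) ⟶ P n ⟶ K n ⟶ 0` pure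
exact. What it resolves is `M` itself, because the counit of the adjunction is an isomorphism when
restriction is fully faithful. By adjunction, vanishing of `PExtⁿ(M, N)` over `R` then forces
vanishing over `S`, so every degree that counts for `S` counts for `R`.

Two tools carry this. `ExtVanishes.of_iso` shows that vanishing can be tested on any resolution.
Purity is handled through finite systems of linear equations, which gives `IsPureEpi.extend` and,
for the failure of flatness, `mono_extend_map`. -/

theorem IsPureEpi.exists_lift {P X Y : ModuleCat.{u} A} (hP : IsPureProjective P) {p : X ⟶ Y}
    (hp : IsPureEpi p) (g : P ⟶ Y) : ∃ h : P ⟶ X, h ≫ p = g := by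
  have := hp.1
  -- Pure epimorphisms are stable under pullback; a section of the pullback along `g` is a lift of
  -- `g`.
  have hsnd : IsPureEpi (Limits.pullback.snd p g) := by
    refine ⟨inferInstance, fun F hF k => ?_⟩
    obtain ⟨h, hh⟩ := hp.2 F hF (k ≫ g)
    exact ⟨Limits.pullback.lift h k hh, Limits.pullback.lift_snd _ _ _⟩
  have := hP _ _ hsnd
  exact ⟨section_ (Limits.pullback.snd p g) ≫ Limits.pullback.fst p g, by
    rw [Category.assoc, Limits.pullback.condition, IsSplitEpi.id_assoc]⟩

/-- A pure projective resolution cut into short exact sequences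
`0 ⟶ K (n + 1) ⟶ P n ⟶ K n ⟶ 0`. -/
structure PureSyzygies (A : Type u) [Ring A] where
  K : ℕ → ModuleCat.{u} A
  P : ℕ → ModuleCat.{u} A
  p : ∀ n, P n ⟶ K n
  i : ∀ n, K (n + 1) ⟶ P n
  pureProjective : ∀ n, IsPureProjective (P n)
  pureEpi : ∀ n, IsPureEpi (p n)
  mono : ∀ n, Mono (i n)
  zero : ∀ n, i n ≫ p n = 0
  exists_lift : ∀ n {F : ModuleCat.{u} A} (g : F ⟶ P n), g ≫ p n = 0 →
    ∃ h : F ⟶ K (n + 1), h ≫ i n = g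

namespace PureSyzygies

/-- The vanishing of the `n`-th pure extension group of `D.K 0` by `N`, in terms of syzygies. -/
def ExtVanishes (D : PureSyzygies A) (N : ModuleCat.{u} A) : ℕ → Prop
  | 0 => ∀ x : D.K 0 ⟶ N, x = 0
  | n + 1 => ∀ x : D.K (n + 1) ⟶ N, ∃ w : D.P n ⟶ N, D.i n ≫ w = x

theorem exists_syzygy_map (D D' : PureSyzygies A) (n : ℕ) (φ : D.K n ⟶ D'.K n) :
    ∃ (Φ : D.P n ⟶ D'.P n) (φ' : D.K (n + 1) ⟶ D'.K (n + 1)),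
      Φ ≫ D'.p n = D.p n ≫ φ ∧ φ' ≫ D'.i n = D.i n ≫ Φ := by
  obtain ⟨Φ, hΦ⟩ := (D'.pureEpi n).exists_lift (D.pureProjective n) (D.p n ≫ φ)
  obtain ⟨φ', hφ'⟩ := D'.exists_lift n (D.i n ≫ Φ) (by
    rw [Category.assoc, hΦ, ← Category.assoc, D.zero, Limits.zero_comp])
  exact ⟨Φ, φ', hΦ, hφ'⟩

/-- One step of the comparison homotopy. The defect `Φ ≫ Ψ - 𝟙`, corrected by `D.p n ≫ δ`, is killed
by `D.p n` and so factors through the next syzygy as `s`; the correction disappears after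
restriction along `D.i n`. -/
theorem exists_stable_retraction_succ (D D' : PureSyzygies A) (n : ℕ) (φ : D.K n ⟶ D'.K n)
    (ψ : D'.K n ⟶ D.K n) (δ : D.K n ⟶ D.P n) (hδ : δ ≫ D.p n = φ ≫ ψ - 𝟙 _) :
    ∃ (Φ : D.P n ⟶ D'.P n) (φ' : D.K (n + 1) ⟶ D'.K (n + 1)) (ψ' : D'.K (n + 1) ⟶ D.K (n + 1))
      (s : D.P n ⟶ D.K (n + 1)),
      φ' ≫ D'.i n = D.i n ≫ Φ ∧ D.i n ≫ s = φ' ≫ ψ' - 𝟙 _ := by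
  obtain ⟨Φ, φ', hΦ, hφ⟩ := exists_syzygy_map D D' n φ
  obtain ⟨Ψ, ψ', hΨ, hψ⟩ := exists_syzygy_map D' D n ψ
  obtain ⟨s, hs⟩ := D.exists_lift n (Φ ≫ Ψ - 𝟙 _ - D.p n ≫ δ) (by
    simp only [Preadditive.sub_comp, Category.assoc, hδ, hΨ, Preadditive.comp_sub]
    rw [← Category.assoc, hΦ]
    simp)
  refine ⟨Φ, φ', ψ', s, hφ, ?_⟩
  have := D.mono n
  rw [← cancel_mono (D.i n), Category.assoc, hs]
  simp only [Preadditive.sub_comp, Category.assoc, hψ, Preadditive.comp_sub]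
  rw [← Category.assoc φ', hφ, ← Category.assoc (D.i n) (D.p n), D.zero]
  simp

theorem exists_stable_retraction (D D' : PureSyzygies A) (e : D.K 0 ≅ D'.K 0) (n : ℕ) :
    ∃ (φ : D.K n ⟶ D'.K n) (ψ : D'.K n ⟶ D.K n) (δ : D.K n ⟶ D.P n),
      δ ≫ D.p n = φ ≫ ψ - 𝟙 _ := by
  induction n with
  | zero => exact ⟨e.hom, e.inv, 0, by simp⟩
  | succ n ih =>
    obtain ⟨φ, ψ, δ, hδ⟩ := ih
    obtain ⟨_, φ', ψ', s, -, hs⟩ := exists_stable_retraction_succ D D' n φ ψ δ hδ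
    -- Pure projectivity of `D.P n` lifts `s` to `D.P (n + 1)`, which restores the inductive
    -- hypothesis.
    obtain ⟨S, hS⟩ := (D.pureEpi (n + 1)).exists_lift (D.pureProjective n) s
    exact ⟨φ', ψ', D.i n ≫ S, by rw [Category.assoc, hS, hs]⟩

theorem ExtVanishes.of_iso {D D' : PureSyzygies A} (e : D.K 0 ≅ D'.K 0) {N : ModuleCat.{u} A}
    {n : ℕ} (h : D'.ExtVanishes N n) : D.ExtVanishes N n := by
  cases n with
  | zero =>
    intro x
    rw [← cancel_epi e.inv, h (e.inv ≫ x), Limits.comp_zero]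
  | succ n =>
    intro x
    obtain ⟨φ, ψ, δ, hδ⟩ := exists_stable_retraction D D' e n
    obtain ⟨Φ, φ', ψ', s, hΦ, hs⟩ := exists_stable_retraction_succ D D' n φ ψ δ hδ
    obtain ⟨w, hw⟩ := h (ψ' ≫ x)
    -- Along `D.i n` the first term restricts to `φ' ≫ ψ' ≫ x` and the second to `(φ' ≫ ψ' - 𝟙) ≫
    -- x`.
    refine ⟨Φ ≫ w - s ≫ x, ?_⟩
    rw [Preadditive.comp_sub, ← Category.assoc, ← hΦ, Category.assoc, hw,
      ← Category.assoc φ', ← Category.assoc (D.i n), hs]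
    simp

end PureSyzygies

/-- The syzygies of the resolution by covers. -/
def coverSyzygies (M : ModuleCat.{u} A) : PureSyzygies A where
  K := syzygy M
  P n := cover (syzygy M n)
  p n := coverMap (syzygy M n)
  i := syzygyι M
  pureProjective n := cover_isPureProjective (syzygy M n)
  pureEpi n := coverMap_isPureEpi (syzygy M n)
  mono := syzygyι_mono M
  zero := syzygyι_coverMap M
  exists_lift n _ g hg := ⟨ModuleCat.ofHom
    (LinearMap.codRestrict (LinearMap.ker (coverMap (syzygy M n)).hom) g.hom
      fun x => LinearMap.mem_ker.2 (congrArg (fun k => k.hom x) hg)), rfl⟩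

theorem coverMap_comp_eq_of_coverD_comp_eq_zero {M N : ModuleCat.{u} A} (n : ℕ)
    (z : cover (syzygy M n) ⟶ N) (hz : coverD M n ≫ z = 0) :
    ∃ x : syzygy M n ⟶ N, coverMap (syzygy M n) ≫ x = z := by
  have hs : Function.Surjective (coverMap (syzygy M n)).hom :=
    (ModuleCat.epi_iff_surjective _).1 (coverMap_isPureEpi (syzygy M n)).1
  have := (coverMap_isPureEpi (syzygy M (n + 1))).1
  have hι : syzygyι M n ≫ z = 0 := by
    rw [← cancel_epi (coverMap (syzygy M (n + 1))), Limits.comp_zero, ← Category.assoc]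
    exact hz
  have hker : LinearMap.ker (coverMap (syzygy M n)).hom ≤ LinearMap.ker z.hom := fun y hy =>
    LinearMap.mem_ker.2 (congrArg (fun k : syzygy M (n + 1) ⟶ N => k.hom ⟨y, hy⟩) hι)
  refine ⟨ModuleCat.ofHom (Submodule.liftQ _ z.hom hker ∘ₗ
    (LinearMap.quotKerEquivOfSurjective _ hs).symm.toLinearMap), ?_⟩
  ext y
  change Submodule.liftQ _ z.hom hker ((LinearMap.quotKerEquivOfSurjective _ hs).symm
    ((coverMap (syzygy M n)).hom y)) = z.hom y
  rw [LinearMap.quotKerEquivOfSurjective_symm_apply]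
  rfl

theorem exactAt_linearYonedaObj_iff (C : ChainComplex (ModuleCat.{u} A) ℕ) (N : ModuleCat.{u} A)
    (i j k : ℕ) (hi : (ComplexShape.up ℕ).prev j = i) (hk : (ComplexShape.up ℕ).next j = k) :
    (C.linearYonedaObj ℤ N).ExactAt j ↔
      ∀ z : C.X j ⟶ N, C.d k j ≫ z = 0 → ∃ w : C.X i ⟶ N, C.d j i ≫ w = z := by
  rw [HomologicalComplex.exactAt_iff' _ i j k hi hk, ShortComplex.moduleCat_exact_iff]
  rfl

theorem coverResolution_complex_d (M : ModuleCat.{u} A) (n : ℕ) :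
    (coverResolution M).complex.d (n + 1) n = coverD M n :=
  ChainComplex.of_d (fun n => cover (syzygy M n)) (coverD M) n

theorem not_nontrivial_PExt_zero_iff (M N : ModuleCat.{u} A) :
    ¬ Nontrivial (PExt 0 M N) ↔ ∀ z : cover (syzygy M 0) ⟶ N, coverD M 0 ≫ z = 0 → z = 0 := by
  -- In degree `0` the predecessor index is again `0` and `d 0 0 = 0`, so the only coboundary is
  -- zero.
  rw [not_nontrivial_iff_subsingleton, ← ModuleCat.isZero_iff_subsingleton, PExt,
    ← HomologicalComplex.exactAt_iff_isZero_homology,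
    exactAt_linearYonedaObj_iff _ _ 0 0 1 (by simp) (by simp), coverResolution_complex_d,
    HomologicalComplex.shape _ 0 0 (by simp)]
  refine forall₂_congr fun z _ => ⟨fun ⟨w, hw⟩ => hw.symm.trans Limits.zero_comp, fun h => ⟨0, ?_⟩⟩
  exact Limits.zero_comp.trans h.symm

theorem not_nontrivial_PExt_succ_iff (n : ℕ) (M N : ModuleCat.{u} A) :
    ¬ Nontrivial (PExt (n + 1) M N) ↔ ∀ z : cover (syzygy M (n + 1)) ⟶ N,
      coverD M (n + 1) ≫ z = 0 → ∃ w : cover (syzygy M n) ⟶ N, coverD M n ≫ w = z := by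
  rw [not_nontrivial_iff_subsingleton, ← ModuleCat.isZero_iff_subsingleton, PExt,
    ← HomologicalComplex.exactAt_iff_isZero_homology,
    exactAt_linearYonedaObj_iff _ _ n (n + 1) (n + 2) (by simp) (by simp),
    coverResolution_complex_d, coverResolution_complex_d]
  rfl

/-- Cocycles on the `n`-th cover are exactly the maps from the `n`-th syzygy; for `n > 0`,
coboundaries are those that extend along the inclusion into the preceding cover. -/
theorem not_nontrivial_PExt_iff (n : ℕ) (M N : ModuleCat.{u} A) :
    ¬ Nontrivial (PExt n M N) ↔ (coverSyzygies M).ExtVanishes N n := by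
  have hepi (k : ℕ) : Epi (coverMap (syzygy M k)) := (coverMap_isPureEpi (syzygy M k)).1
  have hzero (k : ℕ) (x : syzygy M k ⟶ N) : coverD M k ≫ coverMap (syzygy M k) ≫ x = 0 := by
    rw [← Category.assoc, (coverD_pureExact M k).1, Limits.zero_comp]
  cases n with
  | zero =>
    rw [not_nontrivial_PExt_zero_iff]
    change _ ↔ ∀ x : syzygy M 0 ⟶ N, x = 0
    constructor
    · intro h x
      rw [← cancel_epi (coverMap (syzygy M 0)), Limits.comp_zero]
      exact h _ (hzero 0 x)
    · intro h z hz
      obtain ⟨x, rfl⟩ := coverMap_comp_eq_of_coverD_comp_eq_zero 0 z hz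
      rw [h x, Limits.comp_zero]
  | succ n =>
    rw [not_nontrivial_PExt_succ_iff]
    change _ ↔ ∀ x : syzygy M (n + 1) ⟶ N, ∃ w : cover (syzygy M n) ⟶ N, syzygyι M n ≫ w = x
    simp only [coverD, Category.assoc] at hzero ⊢
    constructor
    · intro h x
      obtain ⟨w, hw⟩ := h _ (hzero (n + 1) x)
      exact ⟨w, (cancel_epi (coverMap (syzygy M (n + 1)))).1 hw⟩
    · intro h z hz
      obtain ⟨x, rfl⟩ := coverMap_comp_eq_of_coverD_comp_eq_zero (n + 1) z
        (by simpa only [coverD, Category.assoc] using hz)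
      obtain ⟨w, rfl⟩ := h x
      exact ⟨w, rfl⟩

end Syzygies
-- Purity through finite systems of linear equations.
section Elements

variable {A : Type u} [Ring A]

/-- Finite systems of linear equations with a solution `v` in `Y` have a solution in `X` above
`v`. -/
theorem IsPureEpi.exists_solution {X Y : ModuleCat.{u} A} {p : X ⟶ Y} (hp : IsPureEpi p)
    {ι : Type*} (v : ι → Y) (C : Set (ι →₀ A)) (hC : C.Finite)
    (h : ∀ c ∈ C, Finsupp.linearCombination A v c = 0) :
    ∃ σ : ι → X, (∀ j, p.hom (σ j) = v j) ∧ ∀ c ∈ C, Finsupp.linearCombination A σ c = 0 := by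
  classical
  have hs : Function.Surjective p.hom := (ModuleCat.epi_iff_surjective _).1 hp.1
  -- Only the finitely many unknowns in `T` occur in the equations. They are solved by lifting a map
  -- from the finitely presented module `Aⁿ / W`; the other unknowns get arbitrary preimages.
  let T : Finset ι := hC.toFinset.biUnion Finsupp.support
  let n := T.card
  let t : Fin n → ι := fun k => (T.equivFin.symm k : ι)
  have ht : Function.Injective t := Subtype.val_injective.comp T.equivFin.symm.injective
  let r : (ι →₀ A) → (Fin n → A) := fun c k => c (t k)
  have hr {Z : ModuleCat.{u} A} (w : ι → Z) (c) (hc : c ∈ C) :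
      Fintype.linearCombination A (w ∘ t) (r c) = Finsupp.linearCombination A w c := by
    have hT : c.support ⊆ T := fun x hx => Finset.mem_biUnion.2 ⟨c, hC.mem_toFinset.2 hc, hx⟩
    rw [Finsupp.linearCombination_apply, Finsupp.sum_of_support_subset c hT _ (by simp),
      Fintype.linearCombination_apply, ← Finset.sum_coe_sort T,
      ← T.equivFin.symm.sum_comp]
    rfl
  let W : Submodule A (Fin n → A) := Submodule.span A (r '' C)
  have hW : W.FG := Submodule.fg_def.2 ⟨_, hC.image r, rfl⟩
  have hle : W ≤ LinearMap.ker (Fintype.linearCombination A (v ∘ t)) := by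
    rw [Submodule.span_le]
    rintro _ ⟨c, hc, rfl⟩
    exact LinearMap.mem_ker.2 ((hr v c hc).trans (h c hc))
  obtain ⟨g, hg⟩ := hp.2 (ModuleCat.of A ((Fin n → A) ⧸ W)) (finitePresentation_quotient W hW)
    (ModuleCat.ofHom (W.liftQ _ hle))
  let x : Fin n → X := fun k => g.hom (W.mkQ (Pi.single k 1))
  have hx (k : Fin n) : p.hom (x k) = v (t k) := by
    have := congrArg (fun q => q.hom (W.mkQ (Pi.single k 1))) hg
    refine this.trans ?_
    change Fintype.linearCombination A (v ∘ t) (Pi.single k 1) = _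
    rw [Fintype.linearCombination_apply_single, one_smul]
    rfl
  have hgx : g.hom ∘ₗ W.mkQ = Fintype.linearCombination A x := by
    refine LinearMap.pi_ext' fun k => LinearMap.ext_ring ?_
    simp [x, Fintype.linearCombination_apply_single]
  let σ : ι → X := fun j => if hj : ∃ k, t k = j then x hj.choose else (hs (v j)).choose
  have hσt : σ ∘ t = x := by
    funext k
    have hk : ∃ k', t k' = t k := ⟨k, rfl⟩
    simp only [σ, Function.comp, dif_pos hk]
    rw [ht hk.choose_spec]
  refine ⟨σ, fun j => ?_, fun c hc => ?_⟩
  · by_cases hj : ∃ k, t k = j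
    · obtain ⟨k, rfl⟩ := hj
      rw [← hx k, ← hσt]
      rfl
    · simp only [σ, dif_neg hj]
      exact (hs (v j)).choose_spec
  · rw [← hr σ c hc, hσt, ← hgx]
    change g.hom (W.mkQ (r c)) = 0
    rw [Submodule.mkQ_apply, (Submodule.Quotient.mk_eq_zero W).2 (Submodule.subset_span ⟨c, hc, rfl⟩),
      map_zero]

/-- A map out of a finitely presented module amounts to a solution of its defining relations. One
unknown without equations gives surjectivity. -/
theorem isPureEpi_of_exists_solution {X Y : ModuleCat.{u} A} {p : X ⟶ Y}
    (h : ∀ (n : ℕ) (v : Fin n → Y) (C : Set (Fin n →₀ A)), C.Finite →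
      (∀ c ∈ C, Finsupp.linearCombination A v c = 0) →
      ∃ σ : Fin n → X, (∀ j, p.hom (σ j) = v j) ∧
        ∀ c ∈ C, Finsupp.linearCombination A σ c = 0) : IsPureEpi p := by
  refine ⟨(ModuleCat.epi_iff_surjective _).2 fun y => ?_, fun F hF g => ?_⟩
  · obtain ⟨σ, hσ, -⟩ := h 1 (fun _ => y) ∅ Set.finite_empty (by simp)
    exact ⟨σ 0, hσ 0⟩
  · obtain ⟨n, W, e, C, hC⟩ := Module.FinitePresentation.exists_fin A F
    let E := Finsupp.linearEquivFunOnFinite A A (Fin n)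
    let b : Fin n → F := fun k => e.symm (W.mkQ (Pi.single k 1))
    have hb (c : Fin n →₀ A) : Finsupp.linearCombination A b c = e.symm (W.mkQ (E c)) := by
      change _ = (e.symm.toLinearMap ∘ₗ W.mkQ ∘ₗ E.toLinearMap) c
      refine LinearMap.congr_fun (Finsupp.lhom_ext' fun k => LinearMap.ext_ring ?_) c
      simp [b, E, Finsupp.linearEquivFunOnFinite_single]
    obtain ⟨σ, hσ, hσC⟩ := h n (g.hom ∘ b) (E.symm '' C) (C.finite_toSet.image _) (by
      rintro _ ⟨c, hc, rfl⟩
      rw [← Finsupp.apply_linearCombination, hb, E.apply_symm_apply, Submodule.mkQ_apply,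
        (Submodule.Quotient.mk_eq_zero W).2 (hC ▸ Submodule.subset_span hc), map_zero, map_zero])
    let q : (Fin n → A) →ₗ[A] X := Finsupp.linearCombination A σ ∘ₗ E.symm.toLinearMap
    have hq : W ≤ LinearMap.ker q := by
      rw [← hC, Submodule.span_le]
      intro c hc
      exact LinearMap.mem_ker.2 (hσC _ ⟨c, hc, rfl⟩)
    refine ⟨ModuleCat.ofHom (W.liftQ q hq ∘ₗ e.toLinearMap), ?_⟩
    ext y
    obtain ⟨z, rfl⟩ := e.symm.surjective y
    obtain ⟨z, rfl⟩ := W.mkQ_surjective z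
    obtain ⟨z, rfl⟩ := E.surjective z
    change p.hom (W.liftQ q hq (e (e.symm (W.mkQ (E z))))) = g.hom (e.symm (W.mkQ (E z)))
    rw [e.apply_symm_apply, ← hb, Finsupp.apply_linearCombination]
    change p.hom (Finsupp.linearCombination A σ (E.symm (E z))) = _
    rw [E.symm_apply_apply, Finsupp.apply_linearCombination]
    congr 2
    exact funext hσ

end Elements
-- Extension of scalars and its adjunction with restriction.
section BaseChange

variable {A B : Type u} [Ring A] [Ring B] (g : A →+* B)

/-- Apply a ring homomorphism to the coefficients of a formal linear combination. -/
def mapCoeff {ι : Type*} (c : ι →₀ A) : ι →₀ B := c.mapRange g g.map_zero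

theorem linearCombination_mapCoeff {N : ModuleCat.{u} B} {ι : Type*} (v : ι → N) (c : ι →₀ A) :
    Finsupp.linearCombination B v (mapCoeff g c) =
      Finsupp.linearCombination A (M := (ModuleCat.restrictScalars g).obj N) v c := by
  rw [Finsupp.linearCombination_apply, mapCoeff, Finsupp.sum_mapRange_index (by simp)]
  rfl

/-- A finite system over `A` becomes a finite system over `B` with the same solutions once `g` is
applied to the coefficients. -/
theorem IsPureEpi.restrictScalars {X Y : ModuleCat.{u} B} {p : X ⟶ Y} (hp : IsPureEpi p) :
    IsPureEpi ((ModuleCat.restrictScalars g).map p) := by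
  refine isPureEpi_of_exists_solution fun n v C hC h => ?_
  obtain ⟨σ, hσ, hσC⟩ := hp.exists_solution (ι := Fin n) v (mapCoeff g '' C) (hC.image _) (by
    rintro _ ⟨c, hc, rfl⟩
    exact (linearCombination_mapCoeff g v c).trans (h c hc))
  exact ⟨σ, hσ, fun c hc => (linearCombination_mapCoeff g σ c).symm.trans (hσC _ ⟨c, hc, rfl⟩)⟩

variable (Y : ModuleCat.{u} A)

/-- The images in the free `B`-module on `Y` of all `A`-linear relations in `Y`. -/
def scalarRelations : Set (Y →₀ B) :=
  mapCoeff g '' {c | Finsupp.linearCombination A (id : Y → Y) c = 0}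

/-- The extension of scalars `B ⊗ Y`: the quotient of the free `B`-module on `Y` by the
`A`-linear relations in `Y`. -/
def extendObj : ModuleCat.{u} B :=
  ModuleCat.of B ((Y →₀ B) ⧸ Submodule.span B (scalarRelations g Y))

/-- The projection from the free module on `Y` to `B ⊗ Y`. -/
def extendMk : (Y →₀ B) →ₗ[B] extendObj g Y := (Submodule.span B (scalarRelations g Y)).mkQ

theorem extendMk_surjective : Function.Surjective (extendMk g Y) := Submodule.mkQ_surjective _

variable {Y}

theorem extendMk_eq_zero_iff {c : Y →₀ B} :
    extendMk g Y c = 0 ↔ c ∈ Submodule.span B (scalarRelations g Y) :=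
  Submodule.Quotient.mk_eq_zero _

theorem extendMk_mapCoeff {c : Y →₀ A} (hc : Finsupp.linearCombination A (id : Y → Y) c = 0) :
    extendMk g Y (mapCoeff g c) = 0 :=
  (extendMk_eq_zero_iff g).2 (Submodule.subset_span ⟨c, hc, rfl⟩)

theorem mapCoeff_single {ι : Type*} (y : ι) (a : A) :
    mapCoeff g (Finsupp.single y a) = Finsupp.single y (g a) :=
  Finsupp.mapRange_single

theorem mapCoeff_sub {ι : Type*} (c d : ι →₀ A) :
    mapCoeff g (c - d) = mapCoeff g c - mapCoeff g d :=
  Finsupp.mapRange_sub (by simp) _ _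

/-- The unit `Y ⟶ B ⊗ Y`. -/
def extendUnit : Y ⟶ (ModuleCat.restrictScalars g).obj (extendObj g Y) :=
  ModuleCat.ofHom (Y := (ModuleCat.restrictScalars g).obj (extendObj g Y))
    { toFun := fun y => extendMk g Y (Finsupp.single y 1)
      map_add' := fun y z => by
        have := extendMk_mapCoeff g (Y := Y) (c := Finsupp.single (y + z) 1 - Finsupp.single y 1 -
          Finsupp.single z 1) (by simp)
        rw [mapCoeff_sub, mapCoeff_sub, map_sub, map_sub, sub_sub, sub_eq_zero] at this
        simp only [mapCoeff_single, map_one] at this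
        exact this
      map_smul' := fun a y => by
        have := extendMk_mapCoeff g (Y := Y) (c := Finsupp.single (a • y) 1 - Finsupp.single y a)
          (by simp)
        rw [mapCoeff_sub, map_sub, sub_eq_zero, mapCoeff_single, mapCoeff_single, map_one] at this
        refine this.trans ?_
        rw [← mul_one (g a), ← smul_eq_mul, ← Finsupp.smul_single, map_smul]
        rfl }

/-- The morphism `B ⊗ Y ⟶ N` induced by `Y ⟶ N`. -/
def extendDesc {N : ModuleCat.{u} B} (k : Y ⟶ (ModuleCat.restrictScalars g).obj N) :
    extendObj g Y ⟶ N :=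
  ModuleCat.ofHom (Submodule.liftQ _ (Finsupp.linearCombination B (M := N) k.hom) (by
    rw [Submodule.span_le]
    rintro _ ⟨c, hc, rfl⟩
    refine LinearMap.mem_ker.2 ((linearCombination_mapCoeff g _ c).trans ?_)
    have := congrArg k.hom hc
    rwa [Finsupp.apply_linearCombination, map_zero] at this))

theorem extendDesc_mk_single {N : ModuleCat.{u} B} (k : Y ⟶ (ModuleCat.restrictScalars g).obj N)
    (y : Y) : (extendDesc g k).hom (extendMk g Y (Finsupp.single y 1)) = k.hom y :=
  (Finsupp.linearCombination_single B 1 y (v := (k.hom : Y → N))).trans (one_smul B (k.hom y : N))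

/-- The adjunction bijection between extension and restriction of scalars. -/
def extendHomEquiv (Y : ModuleCat.{u} A) (N : ModuleCat.{u} B) :
    (extendObj g Y ⟶ N) ≃ (Y ⟶ (ModuleCat.restrictScalars g).obj N) where
  toFun h := extendUnit g ≫ (ModuleCat.restrictScalars g).map h
  invFun k := extendDesc g k
  left_inv h := by
    ext c
    obtain ⟨c, rfl⟩ := extendMk_surjective g Y c
    change ((extendDesc g _).hom ∘ₗ extendMk g Y) c = (h.hom ∘ₗ extendMk g Y) c
    refine LinearMap.congr_fun (Finsupp.lhom_ext' fun y => LinearMap.ext_ring ?_) c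
    exact extendDesc_mk_single g _ y
  right_inv k := by
    ext y
    exact extendDesc_mk_single g k y

/-- Extension of scalars along `g`. -/
def extend : ModuleCat.{u} A ⥤ ModuleCat.{u} B :=
  Adjunction.leftAdjointOfEquiv (G := ModuleCat.restrictScalars g) (extendHomEquiv g)
    fun _ _ _ _ _ => by simp [extendHomEquiv]

/-- Extension of scalars is left adjoint to restriction of scalars. -/
def extendAdj : extend g ⊣ ModuleCat.restrictScalars g :=
  Adjunction.adjunctionOfEquivLeft (extendHomEquiv g) _

theorem extend_map_mk {X Y : ModuleCat.{u} A} (p : X ⟶ Y) (c : X →₀ B) :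
    ((extend g).map p).hom (extendMk g X c) = extendMk g Y (c.mapDomain p.hom) := by
  change (((extend g).map p).hom ∘ₗ extendMk g X) c =
    (extendMk g Y ∘ₗ Finsupp.lmapDomain B B p.hom) c
  refine LinearMap.congr_fun (Finsupp.lhom_ext' fun x => LinearMap.ext_ring ?_) c
  change (extendDesc g _).hom (extendMk g X (Finsupp.single x 1)) =
    extendMk g Y (Finsupp.mapDomain p.hom (Finsupp.single x 1))
  rw [extendDesc_mk_single, Finsupp.mapDomain_single]
  rfl

end BaseChange
-- Extension of scalars preserves purity.
section ExtendPurity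

variable {A B : Type u} [Ring A] [Ring B] (g : A →+* B)

theorem mapDomain_mapCoeff {ι κ : Type*} (σ : ι → κ) (c : ι →₀ A) :
    (mapCoeff g c).mapDomain σ = mapCoeff g (c.mapDomain σ) :=
  Finsupp.mapDomain_mapRange σ c g g.map_zero g.map_add

/-- A map of sets that preserves the `A`-linear relations in `C` preserves the relations in the
`B`-span of `C`. -/
theorem extendMk_mapDomain_eq_zero {X : ModuleCat.{u} A} {ι : Type u} (σ : ι → X)
    (C : Set (ι →₀ A)) (hσ : ∀ c ∈ C, Finsupp.linearCombination A σ c = 0) {c : ι →₀ B}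
    (hc : c ∈ Submodule.span B (mapCoeff g '' C)) : extendMk g X (c.mapDomain σ) = 0 := by
  have : Submodule.span B (mapCoeff g '' C) ≤
      LinearMap.ker (extendMk g X ∘ₗ Finsupp.lmapDomain B B σ) := by
    rw [Submodule.span_le]
    rintro _ ⟨c, hc, rfl⟩
    refine LinearMap.mem_ker.2 ?_
    change extendMk g X ((mapCoeff g c).mapDomain σ) = 0
    rw [mapDomain_mapCoeff]
    refine extendMk_mapCoeff g ?_
    rw [Finsupp.linearCombination_mapDomain]
    exact hσ c hc
  exact this hc

/-- Membership of one element in a span involves only finitely many generators, hence finitely many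
`A`-relations. -/
theorem exists_finite_relations {Y : ModuleCat.{u} A} (D : Set (Y →₀ B)) (hD : D.Finite)
    (h : ∀ d ∈ D, extendMk g Y d = 0) :
    ∃ C : Set (Y →₀ A), C.Finite ∧ (∀ c ∈ C, Finsupp.linearCombination A (id : Y → Y) c = 0) ∧
      D ⊆ Submodule.span B (mapCoeff g '' C) := by
  classical
  induction D, hD using Set.Finite.induction_on with
  | empty => exact ⟨∅, Set.finite_empty, by simp, Set.empty_subset _⟩
  | @insert d D _ _ ih =>
    obtain ⟨C, hC, hC0, hDC⟩ := ih fun d hd => h d (Set.mem_insert_of_mem _ hd)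
    obtain ⟨T, hT, hd⟩ := Submodule.mem_span_finite_of_mem_span
      ((extendMk_eq_zero_iff g).1 (h d (Set.mem_insert _ _)))
    obtain ⟨C', hC', hTC'⟩ := Finset.subset_set_image_iff.1 hT
    rw [← hTC', Finset.coe_image] at hd
    refine ⟨C ∪ ↑C', hC.union C'.finite_toSet, ?_, Set.insert_subset ?_ ?_⟩
    · rintro c (hc | hc)
      · exact hC0 c hc
      · exact hC' hc
    · exact Submodule.span_mono (Set.image_mono Set.subset_union_right) hd
    · exact hDC.trans (Submodule.span_mono (Set.image_mono Set.subset_union_left))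

/-- A finite system in `B ⊗ Y`, written on representatives in the free module, holds because of
finitely many `A`-relations `E` in `Y`. Purity gives a set-theoretic section `σ` of `p` that
respects `E`, and `σ` transports the representatives to a solution in `B ⊗ X`. -/
theorem IsPureEpi.extend {X Y : ModuleCat.{u} A} {p : X ⟶ Y} (hp : IsPureEpi p) :
    IsPureEpi ((extend g).map p) := by
  refine isPureEpi_of_exists_solution fun n v C hC h => ?_
  choose w hw using fun k => extendMk_surjective g Y (v k)
  have hcomb {Z : ModuleCat.{u} A} (w : Fin n → Z →₀ B) (c : Fin n →₀ B) :
      Finsupp.linearCombination B (fun k => extendMk g Z (w k)) c =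
        extendMk g Z (Finsupp.linearCombination B w c) :=
    (Finsupp.apply_linearCombination B (extendMk g Z) w c).symm
  obtain ⟨E, hE, hE0, hCE⟩ := exists_finite_relations g
    (Finsupp.linearCombination B w '' C) (hC.image _) (by
      rintro _ ⟨c, hc, rfl⟩
      rw [← hcomb, funext hw]
      exact h c hc)
  obtain ⟨σ, hσ, hσE⟩ := hp.exists_solution id E hE hE0
  refine ⟨fun k => extendMk g X ((w k).mapDomain σ), fun k => ?_, fun c hc => ?_⟩
  · refine (extend_map_mk g p _).trans ?_
    rw [← Finsupp.mapDomain_comp, show p.hom ∘ σ = id from funext hσ, Finsupp.mapDomain_id]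
    exact hw k
  · refine (hcomb _ c).trans ?_
    have : Finsupp.linearCombination B (fun k => (w k).mapDomain σ) c =
        (Finsupp.linearCombination B w c).mapDomain σ :=
      (Finsupp.apply_linearCombination B (Finsupp.lmapDomain B B σ) w c).symm
    rw [this]
    exact extendMk_mapDomain_eq_zero g σ E hσE (hCE ⟨c, hc, rfl⟩)

theorem IsPureProjective.extend {P : ModuleCat.{u} A} (hP : IsPureProjective P) :
    IsPureProjective ((extend g).obj P) := by
  intro X p hp
  obtain ⟨h, hh⟩ := (hp.restrictScalars g).exists_lift hP ((extendAdj g).homEquiv _ _ (𝟙 _))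
  refine IsSplitEpi.mk' ⟨((extendAdj g).homEquiv _ _).symm h, ?_⟩
  rw [← Adjunction.homEquiv_naturality_right_symm, hh, Equiv.symm_apply_apply]

/-- If `c` dies in `B ⊗ X`, finitely many relations `C` in `X` are responsible. A map of sets `ρ : X
→ K` that respects `C` and sends `i k` to `k` on the support of `c` carries them back to `K`, so
that `c` already dies in `B ⊗ K`. -/
theorem mono_extend_map {K X Y : ModuleCat.{u} A} {i : K ⟶ X} {p : X ⟶ Y} (hp : IsPureEpi p)
    (hi : Mono i) (hip : i ≫ p = 0)
    (hker : ∀ {F : ModuleCat.{u} A} (k : F ⟶ X), k ≫ p = 0 → ∃ h : F ⟶ K, h ≫ i = k) :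
    Mono ((extend g).map i) := by
  classical
  have hinj : Function.Injective i.hom := (ModuleCat.mono_iff_injective i).1 hi
  have hex (x : X) (hx : p.hom x = 0) : ∃ k : K, i.hom k = x := by
    obtain ⟨h, hh⟩ := hker (F := ModuleCat.of A A)
      (ModuleCat.ofHom (LinearMap.toSpanSingleton A X x)) (by ext; simpa using hx)
    refine ⟨h.hom (1 : A), ?_⟩
    have := congrArg (fun k => k.hom (1 : A)) hh
    simpa using this
  rw [ModuleCat.mono_iff_injective]
  refine (injective_iff_map_eq_zero ((extend g).map i).hom).2 fun z hz => ?_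
  obtain ⟨c, rfl⟩ := extendMk_surjective g K z
  rw [extend_map_mk] at hz
  obtain ⟨C, hC, hC0, hcC⟩ := exists_finite_relations g {c.mapDomain i.hom}
    (Set.finite_singleton _) (by rintro _ rfl; exact hz)
  -- The unknowns `σ x` lie over `p x`, satisfy `C`, and vanish at `i k` for `k` in the support;
  -- this is consistent in `Y` since `i ≫ p = 0`. Then `ρ x = x - σ x` lies in `K` and has the
  -- required properties.
  obtain ⟨σ, hσ, hσC⟩ := hp.exists_solution p.hom
    (C ∪ (fun k => Finsupp.single (i.hom k) 1) '' (c.support : Set K))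
    (hC.union (c.support.finite_toSet.image _)) (by
      rintro _ (hd | ⟨k, hk, rfl⟩)
      · rw [← Function.comp_id p.hom, ← Finsupp.apply_linearCombination, hC0 _ hd, map_zero]
      · rw [Finsupp.linearCombination_single, one_smul]
        exact congrArg (fun q => q.hom k) hip)
  choose ρ hρ using fun x : X => hex (x - σ x) (by rw [map_sub, hσ, sub_self])
  have hρC : ∀ d ∈ C, Finsupp.linearCombination A ρ d = 0 := fun d hd => by
    apply hinj
    rw [Finsupp.apply_linearCombination, map_zero, show i.hom ∘ ρ = id - σ from funext hρ]
    have : Finsupp.linearCombination A (id - σ) d =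
        Finsupp.linearCombination A id d - Finsupp.linearCombination A σ d := by
      simp [Finsupp.linearCombination_apply, smul_sub]
    rw [this, hC0 d hd, hσC d (Or.inl hd), sub_zero]
  have hρi : ∀ k ∈ c.support, ρ (i.hom k) = k := fun k hk => by
    apply hinj
    have := hσC _ (Or.inr ⟨k, hk, rfl⟩)
    rw [Finsupp.linearCombination_single, one_smul] at this
    rw [hρ, this, sub_zero]
  have := extendMk_mapDomain_eq_zero g ρ C hρC (hcC rfl)
  rw [← Finsupp.mapDomain_comp] at this
  rwa [Finsupp.mapDomain_congr (f := ρ ∘ i.hom) (g := id) hρi, Finsupp.mapDomain_id] at this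

end ExtendPurity

/-! ### Comparison of `PExt` over the two rings. -/

section Comparison

variable {A B : Type u} [Ring A] [Ring B] (g : A →+* B)

instance : (extend g).IsLeftAdjoint := ⟨_, ⟨extendAdj g⟩⟩

instance : (extend g).PreservesZeroMorphisms :=
  Functor.preservesZeroMorphisms_of_isLeftAdjoint _

namespace PureSyzygies

/-- The extension of scalars of a pure projective resolution. -/
def extend (D : PureSyzygies A) : PureSyzygies B where
  K n := (PureDim.extend g).obj (D.K n)
  P n := (PureDim.extend g).obj (D.P n)
  p n := (PureDim.extend g).map (D.p n)
  i n := (PureDim.extend g).map (D.i n)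
  pureProjective n := (D.pureProjective n).extend g
  pureEpi n := (D.pureEpi n).extend g
  mono n := mono_extend_map g (D.pureEpi n) (D.mono n) (D.zero n) (D.exists_lift n)
  zero n := by rw [← Functor.map_comp, D.zero, Functor.map_zero]
  exists_lift n F k hk := by
    have := mono_extend_map g (D.pureEpi n) (D.mono n) (D.zero n) (D.exists_lift n)
    have := (D.pureEpi n).1
    let S := ShortComplex.mk (D.i n) (D.p n) (D.zero n)
    have hS : S.Exact := by
      rw [ShortComplex.exact_iff_exact_up_to_refinements]
      intro F x hx
      obtain ⟨h, hh⟩ := D.exists_lift n x hx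
      exact ⟨F, 𝟙 F, inferInstance, h, by rw [Category.id_comp]; exact hh.symm⟩
    -- A left adjoint preserves cokernels, which gives exactness in the middle; with the
    -- monomorphism on the left, maps killed by the projection lift.
    have hS' : (S.map (PureDim.extend g)).Exact :=
      hS.map_of_epi_of_preservesCokernel (PureDim.extend g) this inferInstance
    have hm : Mono (S.map (PureDim.extend g)).f := ‹Mono ((PureDim.extend g).map (D.i n))›
    exact ⟨hS'.lift k hk, hS'.lift_f k hk⟩

/-- Under the adjunction, extending a map along the extension of `D.i n` is the same as extending
its transpose along `D.i n`. -/
theorem ExtVanishes.extend {D : PureSyzygies A} {N : ModuleCat.{u} B} {n : ℕ}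
    (h : D.ExtVanishes ((ModuleCat.restrictScalars g).obj N) n) :
    (D.extend g).ExtVanishes N n := by
  cases n with
  | zero =>
    intro x
    exact ((extendAdj g).homEquiv (D.K 0) N).injective ((h _).trans (h _).symm)
  | succ n =>
    intro x
    obtain ⟨w, hw⟩ := h ((extendAdj g).homEquiv _ _ x)
    refine ⟨((extendAdj g).homEquiv _ _).symm w, ?_⟩
    change (PureDim.extend g).map (D.i n) ≫ _ = x
    rw [← Adjunction.homEquiv_naturality_left_symm, hw]
    exact Equiv.symm_apply_apply _ _

end PureSyzygies

theorem nontrivial_PExt_restrictScalars [(ModuleCat.restrictScalars.{u} g).Full]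
    {n : ℕ} {M N : ModuleCat.{u} B} (h : Nontrivial (PExt n M N)) :
    Nontrivial (PExt n ((ModuleCat.restrictScalars g).obj M)
      ((ModuleCat.restrictScalars g).obj N)) := by
  by_contra h'
  rw [not_nontrivial_PExt_iff] at h'
  -- Full faithfulness of the right adjoint makes the counit at `M` invertible, so the extended
  -- resolution resolves `M`.
  have e : (coverSyzygies M).K 0 ≅
      ((coverSyzygies ((ModuleCat.restrictScalars g).obj M)).extend g).K 0 :=
    (asIso ((extendAdj g).counit.app M)).symm
  exact (not_nontrivial_PExt_iff n M N).2 ((h'.extend g).of_iso e) h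

theorem moduleCatPgdim_le_of_full [(ModuleCat.restrictScalars.{u} g).Full] :
    moduleCatPgdim B ≤ moduleCatPgdim A :=
  iSup_le fun M => (iSup₂_le fun n ⟨_, hN⟩ => le_iSup₂_of_le n
    ⟨_, nontrivial_PExt_restrictScalars g hN⟩ le_rfl).trans
      (le_iSup ppd ((ModuleCat.restrictScalars g).obj M))

end Comparison
end PureDim

end

theorem mainTheorem3 {R S : Type u} [Ring R] [Ring S] (f : R →+* S)
    (hf : PureDim.IsRingEpi f) :
    PureDim.pgdim S ≤ PureDim.pgdim R := by
  have : (ModuleCat.restrictScalars.{u} (RingHom.op f)).Full := hf.1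
  exact PureDim.moduleCatPgdim_le_of_full (RingHom.op f)
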